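/- Fix a well-formed signature $\Sigma$ of canonical LF (terms in $\beta$-normal, $\eta$-long form; substitution is hereditary substitution indexed by arity types). Let $\preceq$ be the smallest reflexive and transitive relation on the type constants of $\Sigma$ such that $\mathrm{head}(A_i)\preceq a$ for each declaration $a:\Pi x_1{:}A_1\ldots\Pi x_n{:}A_n.\mathrm{Type}$ and $\mathrm{head}(A_i)\preceq\mathrm{head}(A)$ for each declaration $c:\Pi x_1{:}A_1\ldots\Pi x_n{:}A_n.A$ in $\Sigma$; for types, $A\preceq B$ means $\mathrm{head}(A)\preceq\mathrm{head}(B)$. A type, kind, signature or context respects subordination if $A\preceq B$ for every type $\Pi x{:}A.B$ that occurs in it. Assume that $\Sigma$ respects subordination. Formulas of $\mathcal{L}_{LF}$ are built from atomic formulas $\{H\vdash M:A\}$ by $\top,\bot,\supset,\land,\lor$, quantifiers $\forall x{:}\alpha$, $\exists x{:}\alpha$ over terms of arity type $\alpha$, and quantifiers $\Pi\Gamma{:}\mathcal{C}$ over the instances of a context schema $\mathcal{C}$; here $H$ is a context expression, i.e. a context variable or the empty context followed by bindings $n{:}B$ of nominal constants. A closed atomic formula $\{H\vdash M:A\}$ is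 valid if $H$ is a well-formed context, $A$ is a well-formed type in $H$ and $M$ checks against $A$ in $H$; the connectives are interpreted classically and the quantifiers by substitution of all closed terms of the given arity type, respectively of all instances of the schema. For a type $B$, a formula $F$ and a context variable $\Gamma$, say that $B$ is subordinate to $F$ relative to $\Gamma$ if $F$ contains an atomic subformula, with $\Gamma$ free in $F$ at that place, of the form $\{\Gamma\vdash M:A\}$ with $B\preceq A$, or of the form $\{\Gamma,n_1{:}A_1,\ldots,n_k{:}A_k\vdash M:A\}$ with $k\ge 1$. For context expressions $G,G'$ without context variables, $G$ subsumes $G'$ relative to $\Gamma$ and $F$ if $G$ is obtained from $G'$ by deleting some bindings $n{:}B$ whose type $B$ is not subordinate to $F$ relative to $\Gamma$. Theorem. Let $F$ be a formula that is well-formed with respect to assignments $\Psi$ of arity types to term variables and $\Xi$ of context schemas to context variables. Let $\theta$ be a closed substitution for all the variables assigned types by $\Psi$ such that $F[\theta]$ is defined, let $\Gamma$ be a context variable, possibly free in $F$, and let $\sigma$ be a closed substitution for all context variables other than $\Gamma$ that are assigned schemas by $\Xi$. Assume that the type $A$ respects subordination for every atomic subformula $\{\Gamma\vdash M:A\}$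 of $F$ in which $\Gamma$ occurs free in $F$. Then for all closed context expressions $G$ and $G'$ that are well-formed LF contexts, such that $G'$ respects subordination and $G$ subsumes $G'$ relative to $\Gamma$ and $F$, the formula $F[\theta][\sigma][G/\Gamma]$ is valid if and only if $F[\theta][\sigma][G'/\Gamma]$ is valid. -/

import Mathlib

namespace LLF

/-! ### Syntax of canonical LF

Variables bound by a lambda or by a dependent product are de Bruijn indices. Variables of the
logic (bound by formula quantifiers, by block schemas, or free) are named. Nominal constants play
the role of the variables declared in an LF context. -/

/-- Arity types: simple types over the single atomic type `o`. -/
inductive Arity where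
  | o : Arity
  | arr : Arity → Arity → Arity
deriving DecidableEq

/-- Names of term constants. -/
abbrev Con := ℕ
/-- Names of type constants. -/
abbrev Fam := ℕ
/-- Names of term variables. -/
abbrev TVar := ℕ
/-- Names of context variables. -/
abbrev CVar := ℕ

/-- Nominal constants. Each carries its arity type; there are denumerably many of each arity. -/
structure Nom where
  id : ℕ
  arity : Arity
deriving DecidableEq

mutual
/-- Canonical terms `M ::= R | λx.M`. -/
inductive CTm where
  | atom : ATm → CTm
  | lam : CTm → CTm
/-- Atomic terms `R ::= c | x | n | R M`. -/
inductive ATm where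
  | bvar : ℕ → ATm
  | var : TVar → ATm
  | const : Con → ATm
  | nom : Nom → ATm
  | app : ATm → CTm → ATm
end

/-- Atomic type families `P ::= a | P M`. -/
inductive PTy where
  | const : Fam → PTy
  | app : PTy → CTm → PTy

/-- Canonical types `A ::= P | Πx:A.B`; in `pi A B`, the index `0` of `B` is the bound variable. -/
inductive Ty where
  | atom : PTy → Ty
  | pi : Ty → Ty → Ty

/-- Kinds `K ::= Type | Πx:A.K`. -/
inductive Kind where
  | type : Kind
  | pi : Ty → Kind → Kind

/-- Erasure of a type to an arity type. -/
def Ty.erase : Ty → Arity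
  | .atom _ => .o
  | .pi A B => .arr A.erase B.erase

/-- The arities of the arguments demanded by a kind. -/
def Kind.erase : Kind → List Arity
  | .type => []
  | .pi A K => A.erase :: K.erase

/-- Head constant of an atomic type. -/
def PTy.head : PTy → Fam
  | .const a => a
  | .app P _ => P.head

/-- Head constant of a type. -/
def Ty.head : Ty → Fam
  | .atom P => P.head
  | .pi _ B => B.head

/-- The argument types `A₁, …, Aₙ` of a type `Πx₁:A₁ … Πxₙ:Aₙ. P`. -/
def Ty.args : Ty → List Ty
  | .atom _ => []
  | .pi A B => A :: B.args

/-- The argument types `A₁, …, Aₙ` of a kind `Πx₁:A₁ … Πxₙ:Aₙ. Type`. -/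
def Kind.args : Kind → List Ty
  | .type => []
  | .pi A K => A :: K.args

/-- A declaration in a signature. -/
inductive Decl where
  | con : Con → Ty → Decl
  | fam : Fam → Kind → Decl

/-- Signatures, most recent declaration first. -/
abbrev Sig := List Decl

/-- Contexts `n₁:A₁, …, nₖ:Aₖ` without context variables, most recent binding first. -/
abbrev LCtx := List (Nom × Ty)

/-! ### De Bruijn operations -/

mutual
/-- Increment all indices `≥ k`. -/
def CTm.shift (k : ℕ) : CTm → CTm
  | .atom R => .atom (R.shift k)
  | .lam M => .lam (M.shift (k + 1))
/-- Increment all indices `≥ k`. -/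
def ATm.shift (k : ℕ) : ATm → ATm
  | .bvar i => .bvar (if i < k then i else i + 1)
  | .var x => .var x
  | .const c => .const c
  | .nom n => .nom n
  | .app R M => .app (R.shift k) (M.shift k)
end

mutual
/-- Replace the index `k` by the nominal constant `n`, removing the binder of `k`. -/
def CTm.opn (n : Nom) (k : ℕ) : CTm → CTm
  | .atom R => .atom (R.opn n k)
  | .lam M => .lam (M.opn n (k + 1))
/-- Replace the index `k` by the nominal constant `n`, removing the binder of `k`. -/
def ATm.opn (n : Nom) (k : ℕ) : ATm → ATm
  | .bvar i => if i < k then .bvar i else if i = k then .nom n else .bvar (i - 1)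
  | .var x => .var x
  | .const c => .const c
  | .nom m => .nom m
  | .app R M => .app (R.opn n k) (M.opn n k)
end

/-- Replace the index `k` by the nominal constant `n` in an atomic type. -/
def PTy.opn (n : Nom) (k : ℕ) : PTy → PTy
  | .const a => .const a
  | .app P M => .app (P.opn n k) (M.opn n k)

/-- Replace the index `k` by the nominal constant `n` in a type. -/
def Ty.opn (n : Nom) (k : ℕ) : Ty → Ty
  | .atom P => .atom (P.opn n k)
  | .pi A B => .pi (A.opn n k) (B.opn n (k + 1))

/-- Replace the index `k` by the nominal constant `n` in a kind. -/
def Kind.opn (n : Nom) (k : ℕ) : Kind → Kind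
  | .type => .type
  | .pi A K => .pi (A.opn n k) (K.opn n (k + 1))

mutual
/-- No named variable occurs, and all indices that are not bound are `< k`. -/
def CTm.ClosedAt (k : ℕ) : CTm → Prop
  | .atom R => R.ClosedAt k
  | .lam M => M.ClosedAt (k + 1)
/-- No named variable occurs, and all indices that are not bound are `< k`. -/
def ATm.ClosedAt (k : ℕ) : ATm → Prop
  | .bvar i => i < k
  | .var _ => False
  | .const _ => True
  | .nom _ => True
  | .app R M => R.ClosedAt k ∧ M.ClosedAt k
end

/-- No named variable occurs, and all indices that are not bound are `< k`. -/
def PTy.ClosedAt (k : ℕ) : PTy → Prop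
  | .const _ => True
  | .app P M => P.ClosedAt k ∧ M.ClosedAt k

/-- No named variable occurs, and all indices that are not bound are `< k`. -/
def Ty.ClosedAt (k : ℕ) : Ty → Prop
  | .atom P => P.ClosedAt k
  | .pi A B => A.ClosedAt k ∧ B.ClosedAt (k + 1)

/-- A context expression without context variables is closed if all its types are. -/
def LCtx.Closed (G : LCtx) : Prop := ∀ b ∈ G, b.2.ClosedAt 0

/-! ### Hereditary substitution -/

/-- The result of substituting into an atomic term: either an atomic term, when the head of the
term is not replaced, or a canonical term together with an arity type that governs further
reduction. -/
inductive Img where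
  | neu : ATm → Img
  | can : CTm → Arity → Img

/-- Increment all indices of an image. -/
def Img.shift : Img → Img
  | .neu R => .neu (R.shift 0)
  | .can M α => .can (M.shift 0) α

/-- A simultaneous substitution for indices and for named variables. -/
structure Sub where
  idx : ℕ → Img
  named : TVar → Img

/-- The substitution to be used below one more binder. -/
def Sub.lift (s : Sub) : Sub where
  idx
    | 0 => .neu (.bvar 0)
    | i + 1 => (s.idx i).shift
  named x := (s.named x).shift

/-- Substitute `M`, at arity `α`, for the outermost bound variable, removing its binder. -/
def Sub.inst (M : CTm) (α : Arity) : Sub where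
  idx
    | 0 => .can M α
    | i + 1 => .neu (.bvar i)
  named x := .neu (.var x)

/-- Term substitutions `{⟨x₁,M₁,α₁⟩, …}`: `θ x = some (M, α)` stands for `⟨x,M,α⟩ ∈ θ`. -/
abbrev TSub := TVar → Option (CTm × Arity)

/-- The substitution `{⟨x,M,α⟩}`. -/
def TSub.single (x : TVar) (M : CTm) (α : Arity) : TSub :=
  Function.update (fun _ => none) x (some (M, α))

/-- A term substitution affects only named variables. -/
def TSub.toSub (θ : TSub) : Sub where
  idx i := .neu (.bvar i)
  named x := match θ x with
    | some (M, α) => .can M α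
    | none => .neu (.var x)

mutual
/-- `HSubC s M M₁`: the result of applying `s` to the canonical term `M` is defined and is `M₁`. -/
inductive HSubC : Sub → CTm → CTm → Prop where
  | neu {s R R₁} : HSubA s R (.neu R₁) → HSubC s (.atom R) (.atom R₁)
  | can {s R M α} : HSubA s R (.can M α) → HSubC s (.atom R) M
  | lam {s M M₁} : HSubC s.lift M M₁ → HSubC s (.lam M) (.lam M₁)
/-- Substitution into atomic terms. The rule `rename` serves entries `⟨x,n,α⟩` that replace a
variable by a nominal constant of functional arity; it is never used for entries whose term is in
eta-long form. -/
inductive HSubA : Sub → ATm → Img → Prop where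
  | bvar {s i I} : s.idx i = I → HSubA s (.bvar i) I
  | var {s x I} : s.named x = I → HSubA s (.var x) I
  | const {s c} : HSubA s (.const c) (.neu (.const c))
  | nom {s n} : HSubA s (.nom n) (.neu (.nom n))
  | app {s R R₁ M M₁} : HSubA s R (.neu R₁) → HSubC s M M₁ →
      HSubA s (.app R M) (.neu (.app R₁ M₁))
  | beta {s R B α β M M₁ N} : HSubA s R (.can (.lam B) (.arr α β)) → HSubC s M M₁ →
      HSubC (Sub.inst M₁ α) B N → HSubA s (.app R M) (.can N β)
  | rename {s R R₁ α β M M₁} : HSubA s R (.can (.atom R₁) (.arr α β)) → HSubC s M M₁ →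
      HSubA s (.app R M) (.can (.atom (.app R₁ M₁)) β)
end

/-- Substitution into atomic types. -/
inductive HSubP : Sub → PTy → PTy → Prop where
  | const {s a} : HSubP s (.const a) (.const a)
  | app {s P P₁ M M₁} : HSubP s P P₁ → HSubC s M M₁ → HSubP s (.app P M) (.app P₁ M₁)

/-- Substitution into types. -/
inductive HSubT : Sub → Ty → Ty → Prop where
  | atom {s P P₁} : HSubP s P P₁ → HSubT s (.atom P) (.atom P₁)
  | pi {s A A₁ B B₁} : HSubT s A A₁ → HSubT s.lift B B₁ → HSubT s (.pi A B) (.pi A₁ B₁)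

/-- Substitution into kinds. -/
inductive HSubK : Sub → Kind → Kind → Prop where
  | type {s} : HSubK s .type .type
  | pi {s A A₁ K K₁} : HSubT s A A₁ → HSubK s.lift K K₁ → HSubK s (.pi A K) (.pi A₁ K₁)

/-- Substitution into the explicit bindings of a context expression. -/
inductive HSubG : Sub → LCtx → LCtx → Prop where
  | nil {s} : HSubG s [] []
  | cons {s n A A₁ G G₁} : HSubG s G G₁ → HSubT s A A₁ → HSubG s ((n, A) :: G) ((n, A₁) :: G₁)

/-! ### LF judgements

Context bindings are nominal constants. A rule that moves below a binder introduces a new nominal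
constant `n` of the right arity; as usual this is phrased by "all but finitely many `n`". -/

mutual
/-- `K` is a well-formed kind. -/
inductive WfKind (S : Sig) : LCtx → Kind → Prop where
  | type {G} : WfKind S G .type
  | pi {G A K} (L : Finset Nom) : WfTy S G A →
      (∀ n : Nom, n ∉ L → n.arity = A.erase → WfKind S ((n, A) :: G) (K.opn n 0)) →
      WfKind S G (.pi A K)
/-- `A` is a well-formed type. -/
inductive WfTy (S : Sig) : LCtx → Ty → Prop where
  | atom {G P} : SynKind S G P .type → WfTy S G (.atom P)
  | pi {G A B} (L : Finset Nom) : WfTy S G A →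
      (∀ n : Nom, n ∉ L → n.arity = A.erase → WfTy S ((n, A) :: G) (B.opn n 0)) →
      WfTy S G (.pi A B)
/-- The atomic type `P` synthesizes the kind `K`. -/
inductive SynKind (S : Sig) : LCtx → PTy → Kind → Prop where
  | const {G a K} : Decl.fam a K ∈ S → SynKind S G (.const a) K
  | app {G P A K M K₁} : SynKind S G P (.pi A K) → Chk S G M A →
      HSubK (Sub.inst M A.erase) K K₁ → SynKind S G (.app P M) K₁
/-- The canonical term `M` checks against the type `A`. -/
inductive Chk (S : Sig) : LCtx → CTm → Ty → Prop where
  | atom {G R P} : Syn S G R (.atom P) → Chk S G (.atom R) (.atom P)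
  | lam {G A M B} (L : Finset Nom) :
      (∀ n : Nom, n ∉ L → n.arity = A.erase → Chk S ((n, A) :: G) (M.opn n 0) (B.opn n 0)) →
      Chk S G (.lam M) (.pi A B)
/-- The atomic term `R` synthesizes the type `A`. -/
inductive Syn (S : Sig) : LCtx → ATm → Ty → Prop where
  | const {G c A} : Decl.con c A ∈ S → Syn S G (.const c) A
  | nom {G n A} : (n, A) ∈ G → Syn S G (.nom n) A
  | app {G R A B M B₁} : Syn S G R (.pi A B) → Chk S G M A →
      HSubT (Sub.inst M A.erase) B B₁ → Syn S G (.app R M) B₁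
end

/-- `G` is a well-formed context. -/
inductive WfCtx (S : Sig) : LCtx → Prop where
  | nil : WfCtx S []
  | cons {G n A} : WfCtx S G → (∀ b ∈ G, b.1 ≠ n) → n.arity = A.erase → WfTy S G A →
      WfCtx S ((n, A) :: G)

/-- `S` is a well-formed signature. -/
inductive WfSig : Sig → Prop where
  | nil : WfSig []
  | con {S c A} : WfSig S → (∀ B, Decl.con c B ∉ S) → WfTy S [] A → WfSig (.con c A :: S)
  | fam {S a K} : WfSig S → (∀ K₁, Decl.fam a K₁ ∉ S) → WfKind S [] K → WfSig (.fam a K :: S)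

/-! ### Subordination -/

/-- The subordination relation on type constants induced by a signature. -/
inductive Subord (S : Sig) : Fam → Fam → Prop where
  | fam {a K A} : Decl.fam a K ∈ S → A ∈ K.args → Subord S A.head a
  | con {c A B} : Decl.con c A ∈ S → B ∈ A.args → Subord S B.head A.head
  | refl {a K} : Decl.fam a K ∈ S → Subord S a a
  | trans {a b c} : Subord S a b → Subord S b c → Subord S a c

/-- Subordination `A ≼ B` between types. -/
def Ty.Sub (S : Sig) (A B : Ty) : Prop := Subord S A.head B.head

/-- A type respects subordination if `A ≼ B` for every type `Πx:A.B` that occurs in it. -/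
def Ty.Respects (S : Sig) : Ty → Prop
  | .atom _ => True
  | .pi A B => A.Respects S ∧ B.Respects S ∧ A.Sub S B

/-- All types occurring in a kind respect subordination. -/
def Kind.Respects (S : Sig) : Kind → Prop
  | .type => True
  | .pi A K => A.Respects S ∧ K.Respects S

/-- All types occurring in a declaration respect subordination. -/
def Decl.Respects (S : Sig) : Decl → Prop
  | .con _ A => A.Respects S
  | .fam _ K => K.Respects S

/-- All types occurring in a signature respect the subordination relation it induces. -/
def Sig.Respects (S : Sig) : Prop := ∀ d ∈ S, Decl.Respects S d

/-- All types occurring in a context respect subordination. -/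
def LCtx.Respects (S : Sig) (G : LCtx) : Prop := ∀ b ∈ G, b.2.Respects S

/-! ### Arity typing -/

/-- Arity contexts: the nominal constants that may be used and an assignment of arity types to
named variables. The part coming from the signature is supplied by the judgements below. -/
structure ArCtx where
  noms : Set Nom
  vars : TVar → Option Arity

/-- Extend an arity context by `x : α`. -/
def ArCtx.extend (Θ : ArCtx) (x : TVar) (α : Arity) : ArCtx :=
  { Θ with vars := Function.update Θ.vars x (some α) }

/-- The arity context with all nominal constants and the variables in `Ψ`. -/
def ArCtx.full (Ψ : TVar → Option Arity) : ArCtx := ⟨Set.univ, Ψ⟩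

/-- The arity context with all nominal constants and no variables. -/
def ArCtx.closed : ArCtx := ArCtx.full fun _ => none

mutual
/-- Arity typing of canonical terms; the list gives the arities of the indices. -/
inductive ArC (S : Sig) (Θ : ArCtx) : List Arity → CTm → Arity → Prop where
  | atom {D R} : ArA S Θ D R .o → ArC S Θ D (.atom R) .o
  | lam {D M α β} : ArC S Θ (α :: D) M β → ArC S Θ D (.lam M) (.arr α β)
/-- Arity typing of atomic terms. -/
inductive ArA (S : Sig) (Θ : ArCtx) : List Arity → ATm → Arity → Prop where
  | bvar {D i α} : D[i]? = some α → ArA S Θ D (.bvar i) α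
  | var {D x α} : Θ.vars x = some α → ArA S Θ D (.var x) α
  | const {D c A} : Decl.con c A ∈ S → ArA S Θ D (.const c) A.erase
  | nom {D n} : n ∈ Θ.noms → ArA S Θ D (.nom n) n.arity
  | app {D R M α β} : ArA S Θ D R (.arr α β) → ArC S Θ D M α → ArA S Θ D (.app R M) β
end

/-- Arity kinding of atomic types; the second list gives the arities of the missing arguments. -/
inductive ArP (S : Sig) (Θ : ArCtx) : List Arity → PTy → List Arity → Prop where
  | const {D a K} : Decl.fam a K ∈ S → ArP S Θ D (.const a) K.erase
  | app {D P M α l} : ArP S Θ D P (α :: l) → ArC S Θ D M α → ArP S Θ D (.app P M) l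

/-- Arity kinding of types. -/
inductive ArT (S : Sig) (Θ : ArCtx) : List Arity → Ty → Prop where
  | atom {D P} : ArP S Θ D P [] → ArT S Θ D (.atom P)
  | pi {D A B} : ArT S Θ D A → ArT S Θ (A.erase :: D) B → ArT S Θ D (.pi A B)

/-! ### Context schemas -/

/-- Block declarations `y₁:A₁, …, yₘ:Aₘ`, most recent first. -/
abbrev BlockDecl := List (TVar × Ty)

/-- Block schemas `{x₁:α₁, …, xₙ:αₙ}Δ`. -/
structure Block where
  params : List (TVar × Arity)
  decls : BlockDecl

/-- Context schemas. -/
abbrev Schema := List Block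

/-- Well-formedness of a block declaration relative to an arity context, computing the extended
arity context. -/
inductive WfDecls (S : Sig) : ArCtx → BlockDecl → ArCtx → Prop where
  | nil {Θ} : WfDecls S Θ [] Θ
  | cons {Θ Θ₁ y A D} : WfDecls S Θ D Θ₁ → Θ₁.vars y = none → ArT S Θ₁ [] A →
      WfDecls S Θ ((y, A) :: D) (Θ₁.extend y A.erase)

/-- Well-formedness of a block schema. No nominal constants may occur in it. -/
def Block.Wf (S : Sig) (B : Block) : Prop :=
  (B.params.map Prod.fst).Nodup ∧ ∃ Θ₁, WfDecls S ⟨∅, fun x => B.params.lookup x⟩ B.decls Θ₁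

/-- Well-formedness of a context schema. -/
def Schema.Wf (S : Sig) (C : Schema) : Prop := ∀ B ∈ C, Block.Wf S B

/-- Replace the variables declared in a block declaration by nominal constants; the replacement
is recorded in the substitution. -/
inductive DeclInst : BlockDecl → LCtx → TSub → Prop where
  | nil : DeclInst [] [] fun _ => none
  | cons {D G θ y n A A₁} : DeclInst D G θ → n.arity = A.erase → HSubT θ.toSub A A₁ →
      DeclInst ((y, A) :: D) ((n, A₁) :: G)
        (Function.update θ y (some (.atom (.nom n), A.erase)))

/-- The substitution `{⟨xᵢ, t xᵢ, αᵢ⟩}` for the parameters `xᵢ:αᵢ` of a block schema. -/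
def Block.paramSub (B : Block) (t : TVar → CTm) : TSub :=
  fun x => (B.params.lookup x).map fun α => (t x, α)

/-- `G` is an instance of the block schema `B`. -/
def BlockInst (S : Sig) (B : Block) (G : LCtx) : Prop :=
  ∃ (G₀ : LCtx) (θ : TSub) (t : TVar → CTm), DeclInst B.decls G₀ θ ∧
    (∀ p ∈ B.params, ArC S .closed [] (t p.1) p.2) ∧ HSubG (B.paramSub t).toSub G₀ G

/-- `G` is an instance of the context schema `C`; `G₁ ++ G` is the context `G, G₁`. -/
inductive SchemaInst (S : Sig) (C : Schema) : LCtx → Prop where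
  | nil : SchemaInst S C []
  | append {B G G₁} : SchemaInst S C G → B ∈ C → BlockInst S B G₁ → SchemaInst S C (G₁ ++ G)

/-! ### Formulas -/

/-- Formulas. The atomic formula `atm g G M A` is `{g, G ⊢ M : A}`, where the context expression
consists of the explicit bindings `G`, preceded by the context variable `Γ` if `g = some Γ`. -/
inductive Formula where
  | atm : Option CVar → LCtx → CTm → Ty → Formula
  | top : Formula
  | bot : Formula
  | imp : Formula → Formula → Formula
  | and : Formula → Formula → Formula
  | or : Formula → Formula → Formula
  | all : TVar → Arity → Formula → Formula
  | ex : TVar → Arity → Formula → Formula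
  | ctx : CVar → Schema → Formula → Formula

/-- Well-formedness of a formula relative to assignments `Ψ` of arity types to term variables and
`Ξ` of context schemas to context variables. -/
def Formula.Wf (S : Sig) (Ψ : TVar → Option Arity) (Ξ : CVar → Option Schema) : Formula → Prop
  | .atm g G M A => (∀ Γ, g = some Γ → (Ξ Γ).isSome) ∧
      (∀ b ∈ G, ArT S (.full Ψ) [] b.2 ∧ b.1.arity = b.2.erase) ∧
      ArT S (.full Ψ) [] A ∧ ArC S (.full Ψ) [] M A.erase
  | .top => True
  | .bot => True
  | .imp F₁ F₂ => F₁.Wf S Ψ Ξ ∧ F₂.Wf S Ψ Ξ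
  | .and F₁ F₂ => F₁.Wf S Ψ Ξ ∧ F₂.Wf S Ψ Ξ
  | .or F₁ F₂ => F₁.Wf S Ψ Ξ ∧ F₂.Wf S Ψ Ξ
  | .all x α F => F.Wf S (Function.update Ψ x (some α)) Ξ
  | .ex x α F => F.Wf S (Function.update Ψ x (some α)) Ξ
  | .ctx Γ C F => Schema.Wf S C ∧ F.Wf S Ψ (Function.update Ξ Γ (some C))

/-- `HSubF θ F F₁`: the result `F[θ]` is defined and is `F₁`. It is used only for closed `θ`, so
that no bound variable has to be renamed. -/
inductive HSubF : TSub → Formula → Formula → Prop where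
  | atm {θ g G G₁ M M₁ A A₁} : HSubG θ.toSub G G₁ → HSubC θ.toSub M M₁ → HSubT θ.toSub A A₁ →
      HSubF θ (.atm g G M A) (.atm g G₁ M₁ A₁)
  | top {θ} : HSubF θ .top .top
  | bot {θ} : HSubF θ .bot .bot
  | imp {θ F₁ E₁ F₂ E₂} : HSubF θ F₁ E₁ → HSubF θ F₂ E₂ → HSubF θ (.imp F₁ F₂) (.imp E₁ E₂)
  | and {θ F₁ E₁ F₂ E₂} : HSubF θ F₁ E₁ → HSubF θ F₂ E₂ → HSubF θ (.and F₁ F₂) (.and E₁ E₂)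
  | or {θ F₁ E₁ F₂ E₂} : HSubF θ F₁ E₁ → HSubF θ F₂ E₂ → HSubF θ (.or F₁ F₂) (.or E₁ E₂)
  | all {θ x α F F₁} : HSubF (Function.update θ x none) F F₁ → HSubF θ (.all x α F) (.all x α F₁)
  | ex {θ x α F F₁} : HSubF (Function.update θ x none) F F₁ → HSubF θ (.ex x α F) (.ex x α F₁)
  | ctx {θ Γ C F F₁} : HSubF θ F F₁ → HSubF θ (.ctx Γ C F) (.ctx Γ C F₁)

/-- Substitutions `{G₁/Γ₁, …}` of contexts without context variables for context variables. -/
abbrev CSub := CVar → Option LCtx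

/-- The substitution `{G/Γ}`. -/
def CSub.single (Γ : CVar) (G : LCtx) : CSub := Function.update (fun _ => none) Γ (some G)

/-- Application of a context substitution to a formula. It is used only for closed `σ`, so that no
bound variable has to be renamed. -/
def Formula.csub (σ : CSub) : Formula → Formula
  | .atm none G M A => .atm none G M A
  | .atm (some Γ) G M A => match σ Γ with
    | some G₀ => .atm none (G ++ G₀) M A
    | none => .atm (some Γ) G M A
  | .top => .top
  | .bot => .bot
  | .imp F₁ F₂ => .imp (F₁.csub σ) (F₂.csub σ)
  | .and F₁ F₂ => .and (F₁.csub σ) (F₂.csub σ)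
  | .or F₁ F₂ => .or (F₁.csub σ) (F₂.csub σ)
  | .all x α F => .all x α (F.csub σ)
  | .ex x α F => .ex x α (F.csub σ)
  | .ctx Γ C F => .ctx Γ C (F.csub (Function.update σ Γ none))

/-- Size of a formula, used for the recursion that defines validity. -/
def Formula.size : Formula → ℕ
  | .atm _ _ _ _ => 0
  | .top => 0
  | .bot => 0
  | .imp F₁ F₂ => F₁.size + F₂.size + 1
  | .and F₁ F₂ => F₁.size + F₂.size + 1
  | .or F₁ F₂ => F₁.size + F₂.size + 1
  | .all _ _ F => F.size + 1
  | .ex _ _ F => F.size + 1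
  | .ctx _ _ F => F.size + 1

theorem HSubF.size_eq {θ : TSub} {F F₁ : Formula} (h : HSubF θ F F₁) : F₁.size = F.size := by
  induction h <;> simp_all [Formula.size]

theorem Formula.size_csub (F : Formula) : ∀ σ : CSub, (F.csub σ).size = F.size := by
  induction F with
  | atm g G M A =>
    intro σ
    cases g with
    | none => rfl
    | some Γ => simp only [Formula.csub]; split <;> rfl
  | _ => intros; simp_all [Formula.csub, Formula.size]

/-- Validity of closed well-formed formulas. -/
def Valid (S : Sig) : Formula → Prop
  | .atm none G M A => WfCtx S G ∧ WfTy S G A ∧ Chk S G M A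
  | .atm (some _) _ _ _ => False
  | .top => True
  | .bot => False
  | .imp F₁ F₂ => Valid S F₁ → Valid S F₂
  | .and F₁ F₂ => Valid S F₁ ∧ Valid S F₂
  | .or F₁ F₂ => Valid S F₁ ∨ Valid S F₂
  | .all x α F => ∀ M, ArC S .closed [] M α →
      ∃ F₁, ∃ _h : HSubF (.single x M α) F F₁, Valid S F₁
  | .ex x α F => ∃ M, ArC S .closed [] M α ∧
      ∃ F₁, ∃ _h : HSubF (.single x M α) F F₁, Valid S F₁
  | .ctx Γ C F => ∀ G, SchemaInst S C G → Valid S (F.csub (.single Γ G))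
termination_by F => F.size
decreasing_by
  all_goals first
    | (have := HSubF.size_eq _h; simp only [Formula.size]; omega)
    | (simp only [Formula.size, Formula.size_csub]; omega)

/-! ### Subsumption of context expressions -/

/-- The type `A` is subordinate to the formula `F` relative to the context variable `Γ`. -/
inductive TFSub (S : Sig) (A : Ty) (Γ : CVar) : Formula → Prop where
  | ctx {Γ₁ C F} : TFSub S A Γ F → Γ ≠ Γ₁ → TFSub S A Γ (.ctx Γ₁ C F)
  | all {x α F} : TFSub S A Γ F → TFSub S A Γ (.all x α F)
  | ex {x α F} : TFSub S A Γ F → TFSub S A Γ (.ex x α F)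
  | imp_left {F₁ F₂} : TFSub S A Γ F₁ → TFSub S A Γ (.imp F₁ F₂)
  | imp_right {F₁ F₂} : TFSub S A Γ F₂ → TFSub S A Γ (.imp F₁ F₂)
  | and_left {F₁ F₂} : TFSub S A Γ F₁ → TFSub S A Γ (.and F₁ F₂)
  | and_right {F₁ F₂} : TFSub S A Γ F₂ → TFSub S A Γ (.and F₁ F₂)
  | or_left {F₁ F₂} : TFSub S A Γ F₁ → TFSub S A Γ (.or F₁ F₂)
  | or_right {F₁ F₂} : TFSub S A Γ F₂ → TFSub S A Γ (.or F₁ F₂)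
  | atm_nil {M A₁} : A.Sub S A₁ → TFSub S A Γ (.atm (some Γ) [] M A₁)
  | atm_cons {b G M A₁} : TFSub S A Γ (.atm (some Γ) (b :: G) M A₁)

/-- `CESub S Γ F G G₁`: `G` subsumes `G₁` relative to `F` and `Γ`. -/
inductive CESub (S : Sig) (Γ : CVar) (F : Formula) : LCtx → LCtx → Prop where
  | nil : CESub S Γ F [] []
  | keep {G G₁ n A} : CESub S Γ F G G₁ → CESub S Γ F ((n, A) :: G) ((n, A) :: G₁)
  | drop {G G₁ n A} : CESub S Γ F G G₁ → ¬ TFSub S A Γ F → CESub S Γ F G ((n, A) :: G₁)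

/-- `A` respects subordination for every atomic formula `{Γ ⊢ M : A}` that occurs in the formula
with this occurrence of `Γ` free. -/
def Formula.RespectsAt (S : Sig) (Γ : CVar) : Formula → Prop
  | .atm g G _ A => g = some Γ → G = [] → A.Respects S
  | .top => True
  | .bot => True
  | .imp F₁ F₂ => F₁.RespectsAt S Γ ∧ F₂.RespectsAt S Γ
  | .and F₁ F₂ => F₁.RespectsAt S Γ ∧ F₂.RespectsAt S Γ
  | .or F₁ F₂ => F₁.RespectsAt S Γ ∧ F₂.RespectsAt S Γ
  | .all _ _ F => F.RespectsAt S Γ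
  | .ex _ _ F => F.RespectsAt S Γ
  | .ctx Γ₁ _ F => Γ₁ ≠ Γ → F.RespectsAt S Γ

end LLF

-- A term of type `A` can only use context bindings whose type is subordinate to `A`. In an
-- application, the type of the function and the type of the result have the same head constant, and
-- since `Πx:A.B` respects subordination, each argument type lies below that head. Transitivity
-- carries the bound down to every nested argument. So bindings not subordinate to `A` can be
-- deleted without affecting the typing of `M` against `A` (`Chk.strengthen`, `Syn.strengthen`) or
-- the well-formedness of `A` (`WfTy.strengthen`); the converse is weakening.
--
-- To pass from atoms to formulas, `FRel` relates formulas that differ by such harmless exchanges of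
-- `G` and `G'`. It is stable under term substitution, because `G` and `G'` are closed and
-- substitution preserves heads and respect for subordination, and `FRel.valid_iff` shows that it
-- preserves validity. Finally, `CESub.frel` places the two instances of the formula in this
-- relation: where `Γ` stands alone, subsumption keeps exactly what strengthening needs; where
-- explicit bindings follow `Γ`, every type counts as subordinate, which forces `G = G'`.

namespace LLF

/-! ### Substitution acts trivially on closed expressions -/

/-- The substitution fixes all indices `< k`. -/
def Sub.FixesBelow (s : Sub) (k : ℕ) : Prop := ∀ i < k, s.idx i = .neu (.bvar i)

theorem Sub.FixesBelow.lift {s : Sub} {k : ℕ} (h : s.FixesBelow k) :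
    s.lift.FixesBelow (k + 1) := by
  intro i hi
  cases i with
  | zero => rfl
  | succ i => simp [Sub.lift, h i (by omega), Img.shift, ATm.shift]

mutual
-- No head of a closed expression is replaced, so every image stays neutral and the rules `beta` and
-- `rename` cannot fire. With `HSubC.refl_of_closedAt`, substitution into a closed expression is
-- both defined and trivial.
theorem HSubC.eq_of_closedAt {s : Sub} {M M₁ : CTm} (h : HSubC s M M₁) (k : ℕ)
    (hs : s.FixesBelow k) (hM : M.ClosedAt k) : M₁ = M := by
  match h with
  | .neu h =>
    have := HSubA.eq_of_closedAt h k hs (by simpa [CTm.ClosedAt] using hM)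
    simp_all
  | .can h =>
    have := HSubA.eq_of_closedAt h k hs (by simpa [CTm.ClosedAt] using hM)
    simp_all
  | .lam h =>
    rw [HSubC.eq_of_closedAt h (k + 1) hs.lift (by simpa [CTm.ClosedAt] using hM)]
theorem HSubA.eq_of_closedAt {s : Sub} {R : ATm} {I : Img} (h : HSubA s R I) (k : ℕ)
    (hs : s.FixesBelow k) (hR : R.ClosedAt k) : I = .neu R := by
  match h with
  | .bvar h => exact h ▸ hs _ (by simpa [ATm.ClosedAt] using hR)
  | .var _ => simp [ATm.ClosedAt] at hR
  | .const => rfl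
  | .nom => rfl
  | .app h₁ h₂ =>
    simp only [ATm.ClosedAt] at hR
    have e₁ := HSubA.eq_of_closedAt h₁ k hs hR.1
    have e₂ := HSubC.eq_of_closedAt h₂ k hs hR.2
    simp_all
  | .beta h₁ _ _ =>
    simp only [ATm.ClosedAt] at hR
    have e₁ := HSubA.eq_of_closedAt h₁ k hs hR.1
    simp_all
  | .rename h₁ _ =>
    simp only [ATm.ClosedAt] at hR
    have e₁ := HSubA.eq_of_closedAt h₁ k hs hR.1
    simp_all
end

mutual
theorem HSubC.refl_of_closedAt (s : Sub) (M : CTm) (k : ℕ)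
    (hs : s.FixesBelow k) (hM : M.ClosedAt k) : HSubC s M M := by
  match M with
  | .atom R => exact .neu (HSubA.refl_of_closedAt s R k hs (by simpa [CTm.ClosedAt] using hM))
  | .lam M =>
    exact .lam (HSubC.refl_of_closedAt _ M (k + 1) hs.lift (by simpa [CTm.ClosedAt] using hM))
theorem HSubA.refl_of_closedAt (s : Sub) (R : ATm) (k : ℕ)
    (hs : s.FixesBelow k) (hR : R.ClosedAt k) : HSubA s R (.neu R) := by
  match R with
  | .bvar i => exact .bvar (hs _ (by simpa [ATm.ClosedAt] using hR))
  | .var _ => simp [ATm.ClosedAt] at hR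
  | .const _ => exact .const
  | .nom _ => exact .nom
  | .app R M =>
    simp only [ATm.ClosedAt] at hR
    exact .app (HSubA.refl_of_closedAt s R k hs hR.1) (HSubC.refl_of_closedAt s M k hs hR.2)
end

theorem HSubP.eq_of_closedAt {s : Sub} {P P₁ : PTy} (h : HSubP s P P₁) {k : ℕ}
    (hs : s.FixesBelow k) (hP : P.ClosedAt k) : P₁ = P := by
  induction h with
  | const => rfl
  | app _ h₂ ih => rw [ih hP.1, h₂.eq_of_closedAt k hs hP.2]

theorem HSubP.refl_of_closedAt {s : Sub} {P : PTy} {k : ℕ}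
    (hs : s.FixesBelow k) (hP : P.ClosedAt k) : HSubP s P P := by
  induction P with
  | const => exact .const
  | app P M ih => exact .app (ih hP.1) (HSubC.refl_of_closedAt s M k hs hP.2)

theorem HSubT.eq_of_closedAt {s : Sub} {A A₁ : Ty} (h : HSubT s A A₁) {k : ℕ}
    (hs : s.FixesBelow k) (hA : A.ClosedAt k) : A₁ = A := by
  induction h generalizing k with
  | atom h => rw [h.eq_of_closedAt hs hA]
  | pi _ _ ih₁ ih₂ => rw [ih₁ hs hA.1, ih₂ hs.lift hA.2]

theorem HSubT.refl_of_closedAt {s : Sub} {A : Ty} {k : ℕ}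
    (hs : s.FixesBelow k) (hA : A.ClosedAt k) : HSubT s A A := by
  induction A generalizing k s with
  | atom P => exact .atom (HSubP.refl_of_closedAt hs hA)
  | pi A B ih₁ ih₂ => exact .pi (ih₁ hs hA.1) (ih₂ hs.lift hA.2)

theorem HSubG.eq_of_closed {s : Sub} {G G₁ : LCtx} (h : HSubG s G G₁) (hG : G.Closed) :
    G₁ = G := by
  induction h with
  | nil => rfl
  | cons _ h₂ ih =>
    rw [ih fun b hb => hG b (List.mem_cons_of_mem _ hb),
      h₂.eq_of_closedAt (k := 0) (by simp [Sub.FixesBelow]) (hG _ List.mem_cons_self)]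

theorem HSubG.refl_of_closed {s : Sub} {G : LCtx} (hG : G.Closed) : HSubG s G G := by
  induction G with
  | nil => exact .nil
  | cons b G ih =>
    exact .cons (ih fun b hb => hG b (List.mem_cons_of_mem _ hb))
      (HSubT.refl_of_closedAt (k := 0) (by simp [Sub.FixesBelow]) (hG _ List.mem_cons_self))

/-! ### Heads and subordination are stable under substitution -/

theorem PTy.head_opn (n : Nom) (k : ℕ) (P : PTy) : (P.opn n k).head = P.head := by
  induction P with
  | const => rfl
  | app P M ih => exact ih

theorem Ty.head_opn (n : Nom) (k : ℕ) (A : Ty) : (A.opn n k).head = A.head := by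
  induction A generalizing k with
  | atom P => exact P.head_opn n k
  | pi A B _ ih => exact ih _

theorem Ty.Respects.opn {S : Sig} {A : Ty} (h : A.Respects S) (n : Nom) (k : ℕ) :
    (A.opn n k).Respects S := by
  induction A generalizing k with
  | atom P => trivial
  | pi A B ih₁ ih₂ =>
    refine ⟨ih₁ h.1 k, ih₂ h.2.1 (k + 1), ?_⟩
    simpa only [Ty.Sub, Ty.head_opn] using h.2.2

theorem HSubP.head_eq {s : Sub} {P P₁ : PTy} (h : HSubP s P P₁) : P₁.head = P.head := by
  induction h with
  | const => rfl
  | app _ _ ih => exact ih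

theorem HSubT.head_eq {s : Sub} {A A₁ : Ty} (h : HSubT s A A₁) : A₁.head = A.head := by
  induction h with
  | atom h => exact h.head_eq
  | pi _ _ _ ih => exact ih

theorem HSubT.respects {S : Sig} {s : Sub} {A A₁ : Ty} (h : HSubT s A A₁)
    (hA : A.Respects S) : A₁.Respects S := by
  induction h with
  | atom h => trivial
  | pi h₁ h₂ ih₁ ih₂ =>
    refine ⟨ih₁ hA.1, ih₂ hA.2.1, ?_⟩
    simpa only [Ty.Sub, h₁.head_eq, h₂.head_eq] using hA.2.2

theorem HSubK.respects {S : Sig} {s : Sub} {K K₁ : Kind} (h : HSubK s K K₁)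
    (hK : K.Respects S) : K₁.Respects S := by
  induction h with
  | type => trivial
  | pi h₁ h₂ ih => exact ⟨h₁.respects hK.1, ih hK.2⟩

/-- Keeps the bound on the remaining argument types when a family is applied; `p` will be
subordination to the family's head. -/
theorem HSubK.forall_args_head {s : Sub} {K K₁ : Kind} (h : HSubK s K K₁) {p : Fam → Prop}
    (hK : ∀ A ∈ K.args, p A.head) : ∀ A ∈ K₁.args, p A.head := by
  induction h with
  | type => exact hK
  | pi h₁ _ ih =>
    simp only [Kind.args, List.forall_mem_cons] at hK ⊢
    exact ⟨h₁.head_eq ▸ hK.1, ih hK.2⟩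

/-! ### Heads of well-formed types are declared -/

/-- The type constant `a` is declared in `S`. -/
def Sig.Declares (S : Sig) (a : Fam) : Prop := ∃ K, Decl.fam a K ∈ S

theorem Sig.Declares.cons {S : Sig} {a : Fam} (h : S.Declares a) (d : Decl) :
    Sig.Declares (d :: S) a :=
  h.imp fun _ hK => List.mem_cons_of_mem d hK

theorem SynKind.declares_head {S : Sig} {G : LCtx} {P : PTy} {K : Kind} (h : SynKind S G P K) :
    S.Declares P.head := by
  induction P generalizing K with
  | const a => cases h with | const h => exact ⟨_, h⟩
  | app P M ih => cases h with | app h _ _ => exact ih h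

theorem exists_nom_notMem (L : Finset Nom) (α : Arity) : ∃ n : Nom, n ∉ L ∧ n.arity = α := by
  obtain ⟨i, hi⟩ := Infinite.exists_notMem_finset (L.image Nom.id)
  exact ⟨⟨i, α⟩, fun h => hi (Finset.mem_image_of_mem Nom.id h), rfl⟩

theorem Ty.args_opn_head (n : Nom) (k : ℕ) (A : Ty) :
    (A.opn n k).args.map Ty.head = A.args.map Ty.head := by
  induction A generalizing k with
  | atom P => rfl
  | pi A B _ ih => simp [Ty.opn, Ty.args, ih, Ty.head_opn]

theorem Kind.args_opn_head (n : Nom) (k : ℕ) (K : Kind) :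
    (K.opn n k).args.map Ty.head = K.args.map Ty.head := by
  induction K generalizing k with
  | type => rfl
  | pi A K ih => simp [Kind.opn, Kind.args, ih, Ty.head_opn]

/-- Below a binder, one fresh nominal constant of the right arity is enough: opening alters argument
types but not their heads. -/
theorem WfTy.declares_heads {S : Sig} : ∀ {A : Ty} {G : LCtx}, WfTy S G A →
    S.Declares A.head ∧ ∀ a ∈ A.args.map Ty.head, S.Declares a
  | _, _, .atom h => ⟨h.declares_head, by simp [Ty.args]⟩
  | .pi A B, _, .pi L hA hB => by
    obtain ⟨n, hn, hα⟩ := exists_nom_notMem L A.erase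
    have ihA := WfTy.declares_heads hA
    have ihB := WfTy.declares_heads (hB n hn hα)
    rw [Ty.head_opn, Ty.args_opn_head] at ihB
    refine ⟨ihB.1, ?_⟩
    simp only [Ty.args, List.map_cons, List.forall_mem_cons]
    exact ⟨ihA.1, ihB.2⟩

theorem WfKind.declares_heads {S : Sig} : ∀ {K : Kind} {G : LCtx}, WfKind S G K →
    ∀ a ∈ K.args.map Ty.head, S.Declares a
  | _, _, .type => by simp [Kind.args]
  | .pi A K, _, .pi L hA hK => by
    obtain ⟨n, hn, hα⟩ := exists_nom_notMem L A.erase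
    have ih := WfKind.declares_heads (hK n hn hα)
    rw [Kind.args_opn_head] at ih
    simp only [Kind.args, List.map_cons, List.forall_mem_cons]
    exact ⟨hA.declares_heads.1, ih⟩

theorem WfSig.declares_args_con {S : Sig} (hS : WfSig S) {c : Con} {A B : Ty}
    (hA : Decl.con c A ∈ S) (hB : B ∈ A.args) : S.Declares B.head := by
  induction hS with
  | nil => simp at hA
  | con _ _ hw ih =>
    rcases List.mem_cons.1 hA with h | h
    · cases h
      exact (hw.declares_heads.2 _ (List.mem_map_of_mem hB)).cons _
    · exact (ih h).cons _
  | fam _ _ _ ih =>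
    rcases List.mem_cons.1 hA with h | h
    · cases h
    · exact (ih h).cons _

theorem WfSig.declares_args_fam {S : Sig} (hS : WfSig S) {a : Fam} {K : Kind} {B : Ty}
    (hK : Decl.fam a K ∈ S) (hB : B ∈ K.args) : S.Declares B.head := by
  induction hS with
  | nil => simp at hK
  | con _ _ _ ih =>
    rcases List.mem_cons.1 hK with h | h
    · cases h
    · exact (ih h).cons _
  | fam _ _ hw ih =>
    rcases List.mem_cons.1 hK with h | h
    · cases h
      exact (hw.declares_heads _ (List.mem_map_of_mem hB)).cons _
    · exact (ih h).cons _

theorem Sig.Declares.subord_refl {S : Sig} {a : Fam} (h : S.Declares a) : Subord S a a :=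
  h.elim fun _ hK => .refl hK

/-- Reflexivity is postulated for declared constants only. The left end of a generating step is the
head of an argument type in a well-formed signature, hence declared. -/
theorem Subord.refl_left {S : Sig} (hS : WfSig S) {a b : Fam} (h : Subord S a b) :
    Subord S a a := by
  induction h with
  | fam hK hA => exact (hS.declares_args_fam hK hA).subord_refl
  | con hA hB => exact (hS.declares_args_con hA hB).subord_refl
  | refl h => exact .refl h
  | trans _ _ ih _ => exact ih

theorem WfCtx.sub_refl {S : Sig} {G : LCtx} (hG : WfCtx S G) : ∀ b ∈ G, b.2.Sub S b.2 := by
  induction hG with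
  | nil => simp
  | cons _ _ _ hA ih => exact List.forall_mem_cons.2 ⟨hA.declares_heads.1.subord_refl, ih⟩

/-! ### Weakening and strengthening of LF judgements -/

mutual
-- These judgements consult the context only through membership, so inclusion suffices and the
-- excluded finite set of names need not change.
theorem WfTy.weaken {S : Sig} {G G' : LCtx} {A : Ty} (h : WfTy S G A) (hG : G ⊆ G') :
    WfTy S G' A := by
  match h with
  | .atom h => exact .atom (SynKind.weaken h hG)
  | .pi L hA hB =>
    exact .pi L (WfTy.weaken hA hG) fun n hn hα =>
      WfTy.weaken (hB n hn hα) (List.cons_subset_cons _ hG)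
theorem SynKind.weaken {S : Sig} {G G' : LCtx} {P : PTy} {K : Kind} (h : SynKind S G P K)
    (hG : G ⊆ G') : SynKind S G' P K := by
  match h with
  | .const h => exact .const h
  | .app hP hM hK => exact .app (SynKind.weaken hP hG) (Chk.weaken hM hG) hK
theorem Chk.weaken {S : Sig} {G G' : LCtx} {M : CTm} {A : Ty} (h : Chk S G M A)
    (hG : G ⊆ G') : Chk S G' M A := by
  match h with
  | .atom h => exact .atom (Syn.weaken h hG)
  | .lam L h =>
    exact .lam L fun n hn hα => Chk.weaken (h n hn hα) (List.cons_subset_cons _ hG)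
theorem Syn.weaken {S : Sig} {G G' : LCtx} {R : ATm} {A : Ty} (h : Syn S G R A)
    (hG : G ⊆ G') : Syn S G' R A := by
  match h with
  | .const h => exact .const h
  | .nom h => exact .nom (hG h)
  | .app hR hM hB => exact .app (Syn.weaken hR hG) (Chk.weaken hM hG) hB
end

/-- All bindings of `G'` whose type is subordinate to `a` occur in `G`. -/
def LCtx.Keeps (S : Sig) (a : Fam) (G G' : LCtx) : Prop :=
  ∀ b ∈ G', Subord S b.2.head a → b ∈ G

theorem LCtx.Keeps.cons {S : Sig} {a : Fam} {G G' : LCtx} (h : LCtx.Keeps S a G G')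
    (b : Nom × Ty) : LCtx.Keeps S a (b :: G) (b :: G') :=
  List.forall_mem_cons.2
    ⟨fun _ => List.mem_cons_self, fun c hc hs => List.mem_cons_of_mem _ (h c hc hs)⟩

theorem LCtx.Keeps.mono {S : Sig} {a b : Fam} {G G' : LCtx} (h : LCtx.Keeps S b G G')
    (hab : Subord S a b) : LCtx.Keeps S a G G' :=
  fun c hc hs => h c hc (hs.trans hab)

/-- The types in `G` respect subordination and are subordinate to themselves. -/
def LCtx.Good (S : Sig) (G : LCtx) : Prop := ∀ b ∈ G, b.2.Respects S ∧ b.2.Sub S b.2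

/-- Self-subordination of the new binding comes from `A ≼ B` through `Subord.refl_left`. -/
theorem LCtx.Good.cons {S : Sig} (hS : WfSig S) {G : LCtx} (h : LCtx.Good S G) {A B : Ty}
    (hA : (Ty.pi A B).Respects S) (n : Nom) : LCtx.Good S ((n, A) :: G) :=
  List.forall_mem_cons.2 ⟨⟨hA.1, hA.2.2.refl_left hS⟩, h⟩

mutual
theorem Chk.strengthen {S : Sig} (hS : WfSig S) (hSr : S.Respects) {G G' : LCtx} {M : CTm}
    {A : Ty} (h : Chk S G' M A) (hA : A.Respects S) (hG' : G'.Good S)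
    (hk : LCtx.Keeps S A.head G G') : Chk S G M A := by
  match h with
  | .atom h => exact .atom (Syn.strengthen hS hSr h hG' hk).1
  | .lam L h =>
    exact .lam L fun n hn hα => Chk.strengthen hS hSr (h n hn hα) (hA.2.1.opn n 0)
      (hG'.cons hS hA n) (by rw [Ty.head_opn]; exact hk.cons _)
-- The synthesized type is not given in advance, so its respect for subordination has to be part of
-- the conclusion; the application case relies on it.
theorem Syn.strengthen {S : Sig} (hS : WfSig S) (hSr : S.Respects) {G G' : LCtx} {R : ATm}
    {A : Ty} (h : Syn S G' R A) (hG' : G'.Good S)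
    (hk : LCtx.Keeps S A.head G G') : Syn S G R A ∧ A.Respects S := by
  match h with
  | .const h => exact ⟨.const h, hSr _ h⟩
  -- The binding survives because its type is subordinate to itself.
  | .nom h => exact ⟨.nom (hk _ h (hG' _ h).2), (hG' _ h).1⟩
  | .app hR hM hB =>
    -- The result type has the same head as `Πx:A.B`, so the condition on `G` passes to `R`
    -- unchanged.
    rw [hB.head_eq] at hk
    obtain ⟨hR', hr⟩ := Syn.strengthen hS hSr hR hG' hk
    -- `A ≼ B` and transitivity supply the condition at the argument type.
    exact ⟨.app hR' (Chk.strengthen hS hSr hM hr.1 hG' (hk.mono hr.2.2)) hB,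
      hB.respects hr.2.1⟩
end

/-- For families the bound on arguments is a generator of `Subord` at the head constant, and is then
carried along each application. -/
theorem SynKind.strengthen {S : Sig} (hS : WfSig S) (hSr : S.Respects) {G G' : LCtx} {P : PTy}
    {K : Kind} (h : SynKind S G' P K) (hG' : G'.Good S) (hk : LCtx.Keeps S P.head G G') :
    SynKind S G P K ∧ K.Respects S ∧ ∀ A ∈ K.args, Subord S A.head P.head := by
  induction P generalizing K with
  | const a =>
    cases h with
    | const h => exact ⟨.const h, hSr _ h, fun A hA => .fam h hA⟩
  | app P M ih =>
    cases h with
    | app hP hM hK =>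
      obtain ⟨hP', hr, hs⟩ := ih hP hk
      simp only [Kind.args, List.forall_mem_cons] at hs
      exact ⟨.app hP' (hM.strengthen hS hSr hr.1 hG' (hk.mono hs.1)) hK, hK.respects hr.2,
        hK.forall_args_head (p := fun a => Subord S a P.head) hs.2⟩

theorem WfTy.strengthen {S : Sig} (hS : WfSig S) (hSr : S.Respects) :
    ∀ {A : Ty} {G G' : LCtx}, WfTy S G' A → A.Respects S → G'.Good S →
      LCtx.Keeps S A.head G G' → WfTy S G A
  | _, _, _, .atom h, _, hG', hk => .atom (h.strengthen hS hSr hG' hk).1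
  | .pi A B, _, _, .pi L hA hB, hr, hG', hk =>
    .pi L (WfTy.strengthen hS hSr hA hr.1 hG' (hk.mono hr.2.2)) fun n hn hα =>
      WfTy.strengthen hS hSr (hB n hn hα) (hr.2.1.opn n 0) (hG'.cons hS hr n)
        (by rw [Ty.head_opn]; exact hk.cons _)

/-! ### Formulas that differ in the contexts of some atomic subformulas -/

/-- `FRel S G G' E E'`: the formula `E'` arises from `E` by replacing `G` by `G'` in some atomic
subformulas `{G ⊢ M : A}` such that `A` respects subordination and `G` contains all bindings of
`G'` whose types are subordinate to `A`. -/
inductive FRel (S : Sig) (G G' : LCtx) : Formula → Formula → Prop where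
  | same {g H M A} : FRel S G G' (.atm g H M A) (.atm g H M A)
  | swap {M A} : A.Respects S → LCtx.Keeps S A.head G G' →
      FRel S G G' (.atm none G M A) (.atm none G' M A)
  | top : FRel S G G' .top .top
  | bot : FRel S G G' .bot .bot
  | imp {E₁ E₁' E₂ E₂'} : FRel S G G' E₁ E₁' → FRel S G G' E₂ E₂' →
      FRel S G G' (.imp E₁ E₂) (.imp E₁' E₂')
  | and {E₁ E₁' E₂ E₂'} : FRel S G G' E₁ E₁' → FRel S G G' E₂ E₂' →
      FRel S G G' (.and E₁ E₂) (.and E₁' E₂')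
  | or {E₁ E₁' E₂ E₂'} : FRel S G G' E₁ E₁' → FRel S G G' E₂ E₂' →
      FRel S G G' (.or E₁ E₂) (.or E₁' E₂')
  | all {x α E E'} : FRel S G G' E E' → FRel S G G' (.all x α E) (.all x α E')
  | ex {x α E E'} : FRel S G G' E E' → FRel S G G' (.ex x α E) (.ex x α E')
  | ctx {Δ C E E'} : FRel S G G' E E' → FRel S G G' (.ctx Δ C E) (.ctx Δ C E')

theorem FRel.refl {S : Sig} {G G' : LCtx} (E : Formula) : FRel S G G' E E := by
  induction E with
  | atm => exact .same
  | top => exact .top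
  | bot => exact .bot
  | imp _ _ h₁ h₂ => exact .imp h₁ h₂
  | and _ _ h₁ h₂ => exact .and h₁ h₂
  | or _ _ h₁ h₂ => exact .or h₁ h₂
  | all _ _ _ h => exact .all h
  | ex _ _ _ h => exact .ex h
  | ctx _ _ _ h => exact .ctx h

theorem FRel.csub {S : Sig} {G G' : LCtx} {E E' : Formula} (h : FRel S G G' E E') (τ : CSub) :
    FRel S G G' (E.csub τ) (E'.csub τ) := by
  induction h generalizing τ with
  | same => exact .refl _
  | swap h₁ h₂ => exact .swap h₁ h₂
  | top => exact .top
  | bot => exact .bot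
  | imp _ _ h₁ h₂ => exact .imp (h₁ τ) (h₂ τ)
  | and _ _ h₁ h₂ => exact .and (h₁ τ) (h₂ τ)
  | or _ _ h₁ h₂ => exact .or (h₁ τ) (h₂ τ)
  | all _ h => exact .all (h τ)
  | ex _ h => exact .ex (h τ)
  | ctx _ h => exact .ctx (h _)

theorem FRel.hsub {S : Sig} {G G' : LCtx} (hG : G.Closed) (hG' : G'.Closed) {E E' : Formula}
    (h : FRel S G G' E E') {θ : TSub} {F : Formula} (hF : HSubF θ E F) :
    ∃ F', HSubF θ E' F' ∧ FRel S G G' F F' := by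
  induction h generalizing θ F with
  | same => exact ⟨F, hF, .refl _⟩
  | swap hA hk =>
    cases hF with
    | atm h₁ h₂ h₃ =>
      cases h₁.eq_of_closed hG
      exact ⟨_, .atm (.refl_of_closed hG') h₂ h₃, .swap (h₃.respects hA) (h₃.head_eq ▸ hk)⟩
  | top => cases hF; exact ⟨_, .top, .top⟩
  | bot => cases hF; exact ⟨_, .bot, .bot⟩
  | imp _ _ ih₁ ih₂ =>
    cases hF with
    | imp h₁ h₂ =>
      obtain ⟨_, h₁, r₁⟩ := ih₁ h₁
      obtain ⟨_, h₂, r₂⟩ := ih₂ h₂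
      exact ⟨_, .imp h₁ h₂, .imp r₁ r₂⟩
  | and _ _ ih₁ ih₂ =>
    cases hF with
    | and h₁ h₂ =>
      obtain ⟨_, h₁, r₁⟩ := ih₁ h₁
      obtain ⟨_, h₂, r₂⟩ := ih₂ h₂
      exact ⟨_, .and h₁ h₂, .and r₁ r₂⟩
  | or _ _ ih₁ ih₂ =>
    cases hF with
    | or h₁ h₂ =>
      obtain ⟨_, h₁, r₁⟩ := ih₁ h₁
      obtain ⟨_, h₂, r₂⟩ := ih₂ h₂
      exact ⟨_, .or h₁ h₂, .or r₁ r₂⟩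
  | all _ ih =>
    cases hF with
    | all h =>
      obtain ⟨_, h, r⟩ := ih h
      exact ⟨_, .all h, .all r⟩
  | ex _ ih =>
    cases hF with
    | ex h =>
      obtain ⟨_, h, r⟩ := ih h
      exact ⟨_, .ex h, .ex r⟩
  | ctx _ ih =>
    cases hF with
    | ctx h =>
      obtain ⟨_, h, r⟩ := ih h
      exact ⟨_, .ctx h, .ctx r⟩

/-- The reverse transfer is needed as well, since validity of a quantified formula asks that the
substitution instance exist. -/
theorem FRel.hsub' {S : Sig} {G G' : LCtx} (hG : G.Closed) (hG' : G'.Closed) {E E' : Formula}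
    (h : FRel S G G' E E') {θ : TSub} {F' : Formula} (hF : HSubF θ E' F') :
    ∃ F, HSubF θ E F ∧ FRel S G G' F F' := by
  induction h generalizing θ F' with
  | same => exact ⟨F', hF, .refl _⟩
  | swap hA hk =>
    cases hF with
    | atm h₁ h₂ h₃ =>
      cases h₁.eq_of_closed hG'
      exact ⟨_, .atm (.refl_of_closed hG) h₂ h₃, .swap (h₃.respects hA) (h₃.head_eq ▸ hk)⟩
  | top => cases hF; exact ⟨_, .top, .top⟩
  | bot => cases hF; exact ⟨_, .bot, .bot⟩
  | imp _ _ ih₁ ih₂ =>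
    cases hF with
    | imp h₁ h₂ =>
      obtain ⟨_, h₁, r₁⟩ := ih₁ h₁
      obtain ⟨_, h₂, r₂⟩ := ih₂ h₂
      exact ⟨_, .imp h₁ h₂, .imp r₁ r₂⟩
  | and _ _ ih₁ ih₂ =>
    cases hF with
    | and h₁ h₂ =>
      obtain ⟨_, h₁, r₁⟩ := ih₁ h₁
      obtain ⟨_, h₂, r₂⟩ := ih₂ h₂
      exact ⟨_, .and h₁ h₂, .and r₁ r₂⟩
  | or _ _ ih₁ ih₂ =>
    cases hF with
    | or h₁ h₂ =>
      obtain ⟨_, h₁, r₁⟩ := ih₁ h₁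
      obtain ⟨_, h₂, r₂⟩ := ih₂ h₂
      exact ⟨_, .or h₁ h₂, .or r₁ r₂⟩
  | all _ ih =>
    cases hF with
    | all h =>
      obtain ⟨_, h, r⟩ := ih h
      exact ⟨_, .all h, .all r⟩
  | ex _ ih =>
    cases hF with
    | ex h =>
      obtain ⟨_, h, r⟩ := ih h
      exact ⟨_, .ex h, .ex r⟩
  | ctx _ ih =>
    cases hF with
    | ctx h =>
      obtain ⟨_, h, r⟩ := ih h
      exact ⟨_, .ctx h, .ctx r⟩

/-- The induction is on size because quantifiers lead to substitution instances, which are not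
subformulas. -/
theorem FRel.valid_iff {S : Sig} (hS : WfSig S) (hSr : S.Respects) {G G' : LCtx}
    (hGc : G.Closed) (hGc' : G'.Closed) (hG : WfCtx S G) (hG' : WfCtx S G')
    (hGr' : G'.Respects S) (hsub : G ⊆ G') {E E' : Formula} (h : FRel S G G' E E') :
    Valid S E ↔ Valid S E' := by
  induction hn : E.size using Nat.strong_induction_on generalizing E E' with
  | _ m IH =>
  subst hn
  cases h with
  | same => rfl
  | swap hA hk =>
    simp only [Valid]
    have hgood : G'.Good S := fun b hb => ⟨hGr' b hb, hG'.sub_refl b hb⟩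
    exact ⟨fun ⟨_, h₂, h₃⟩ => ⟨hG', h₂.weaken hsub, h₃.weaken hsub⟩, fun ⟨_, h₂, h₃⟩ =>
      ⟨hG, h₂.strengthen hS hSr hA hgood hk, h₃.strengthen hS hSr hA hgood hk⟩⟩
  | top => rfl
  | bot => rfl
  | imp h₁ h₂ =>
    simp only [Valid]
    rw [IH _ (by simp only [Formula.size]; omega) h₁ rfl,
      IH _ (by simp only [Formula.size]; omega) h₂ rfl]
  | and h₁ h₂ =>
    simp only [Valid]
    rw [IH _ (by simp only [Formula.size]; omega) h₁ rfl,
      IH _ (by simp only [Formula.size]; omega) h₂ rfl]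
  | or h₁ h₂ =>
    simp only [Valid]
    rw [IH _ (by simp only [Formula.size]; omega) h₁ rfl,
      IH _ (by simp only [Formula.size]; omega) h₂ rfl]
  | all h =>
    simp only [Valid]
    refine forall₂_congr fun M _ => ⟨fun ⟨F₁, hF, hv⟩ => ?_, fun ⟨F₁, hF, hv⟩ => ?_⟩
    · obtain ⟨F', hF', r⟩ := h.hsub hGc hGc' hF
      exact ⟨F', hF', (IH _ (by rw [hF.size_eq]; simp [Formula.size]) r rfl).1 hv⟩
    · obtain ⟨F', hF', r⟩ := h.hsub' hGc hGc' hF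
      exact ⟨F', hF', (IH _ (by rw [hF'.size_eq]; simp [Formula.size]) r rfl).2 hv⟩
  | ex h =>
    simp only [Valid]
    refine exists_congr fun M => and_congr_right fun _ =>
      ⟨fun ⟨F₁, hF, hv⟩ => ?_, fun ⟨F₁, hF, hv⟩ => ?_⟩
    · obtain ⟨F', hF', r⟩ := h.hsub hGc hGc' hF
      exact ⟨F', hF', (IH _ (by rw [hF.size_eq]; simp [Formula.size]) r rfl).1 hv⟩
    · obtain ⟨F', hF', r⟩ := h.hsub' hGc hGc' hF
      exact ⟨F', hF', (IH _ (by rw [hF'.size_eq]; simp [Formula.size]) r rfl).2 hv⟩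
  | ctx h =>
    simp only [Valid]
    exact forall₂_congr fun H _ =>
      IH _ (by simp [Formula.size_csub, Formula.size]) (h.csub _) rfl

/-! ### Subsumption -/

theorem CESub.mono {S : Sig} {Γ : CVar} {F E : Formula} {G G' : LCtx}
    (h : CESub S Γ F G G') (hEF : ∀ A, TFSub S A Γ E → TFSub S A Γ F) : CESub S Γ E G G' := by
  induction h with
  | nil => exact .nil
  | keep _ ih => exact .keep ih
  | drop _ hn ih => exact .drop ih (mt (hEF _) hn)

theorem CESub.subset {S : Sig} {Γ : CVar} {F : Formula} {G G' : LCtx}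
    (h : CESub S Γ F G G') : G ⊆ G' := by
  induction h with
  | nil => exact List.Subset.refl _
  | keep _ ih => exact List.cons_subset_cons _ ih
  | drop _ _ ih => exact List.subset_cons_of_subset _ ih

theorem CESub.mem_of_tfsub {S : Sig} {Γ : CVar} {F : Formula} {G G' : LCtx}
    (h : CESub S Γ F G G') : ∀ b ∈ G', TFSub S b.2 Γ F → b ∈ G := by
  induction h with
  | nil => simp
  | keep _ ih =>
    exact List.forall_mem_cons.2
      ⟨fun _ => List.mem_cons_self, fun b hb hs => List.mem_cons_of_mem _ (ih b hb hs)⟩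
  | drop _ hn ih => exact List.forall_mem_cons.2 ⟨fun hs => absurd hs hn, ih⟩

theorem CESub.eq_of_forall_tfsub {S : Sig} {Γ : CVar} {F : Formula} {G G' : LCtx}
    (h : CESub S Γ F G G') (hF : ∀ A, TFSub S A Γ F) : G = G' := by
  induction h with
  | nil => rfl
  | keep _ ih => rw [ih]
  | drop _ hn _ => exact absurd (hF _) hn

/-- Subsumption and the respect condition refer to `F` before substitution. Induction on the
derivation of `E` keeps each atom paired with its original, which has the same head. -/
theorem CESub.frel {S : Sig} {Γ : CVar} {G G' : LCtx} {θ : TSub} {F E : Formula}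
    (hE : HSubF θ F E) (hr : F.RespectsAt S Γ) (hsub : CESub S Γ F G G') {σ : CSub}
    (hσ : σ Γ = none) :
    FRel S G G' ((E.csub σ).csub (.single Γ G)) ((E.csub σ).csub (.single Γ G')) := by
  induction hE generalizing σ with
  | @atm θ g H H₁ M M₁ A A₁ hH _ hA =>
    cases g with
    | none => exact .same
    | some Δ =>
      by_cases hΔ : Δ = Γ
      · subst hΔ
        simp only [Formula.csub, hσ, CSub.single, Function.update_self]
        cases hH with
        | nil =>
          refine .swap (hA.respects (hr rfl rfl)) fun b hb hs => hsub.mem_of_tfsub b hb (.atm_nil ?_)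
          rwa [hA.head_eq] at hs
        | cons _ _ =>
          -- Explicit bindings make every type subordinate, so nothing was dropped.
          rw [hsub.eq_of_forall_tfsub fun _ => .atm_cons]
          exact .same
      · cases h : σ Δ with
        | some H => simp only [Formula.csub, h]; exact .same
        | none =>
          simp only [Formula.csub, h, CSub.single, Function.update_of_ne hΔ]
          exact .same
  | top => exact .top
  | bot => exact .bot
  | imp _ _ ih₁ ih₂ =>
    exact .imp (ih₁ hr.1 (hsub.mono fun _ => .imp_left) hσ)
      (ih₂ hr.2 (hsub.mono fun _ => .imp_right) hσ)
  | and _ _ ih₁ ih₂ =>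
    exact .and (ih₁ hr.1 (hsub.mono fun _ => .and_left) hσ)
      (ih₂ hr.2 (hsub.mono fun _ => .and_right) hσ)
  | or _ _ ih₁ ih₂ =>
    exact .or (ih₁ hr.1 (hsub.mono fun _ => .or_left) hσ)
      (ih₂ hr.2 (hsub.mono fun _ => .or_right) hσ)
  | all _ ih => exact .all (ih hr (hsub.mono fun _ => .all) hσ)
  | ex _ ih => exact .ex (ih hr (hsub.mono fun _ => .ex) hσ)
  | @ctx θ Δ C F E _ ih =>
    by_cases hΔ : Δ = Γ
    · subst hΔ
      -- The quantifier rebinds `Γ`, so neither `G` nor `G'` enters the body and both sides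
      -- coincide.
      simp only [Formula.csub, CSub.single, Function.update_idem]
      exact .refl _
    · have hs : ∀ H : LCtx, Function.update (CSub.single Γ H) Δ none = CSub.single Γ H :=
        fun H => Function.update_eq_self_iff.2 (by simp [CSub.single, Function.update_of_ne hΔ])
      simp only [Formula.csub, hs]
      exact .ctx (ih (hr hΔ) (hsub.mono fun _ h => .ctx h (Ne.symm hΔ))
        (by rwa [Function.update_of_ne (Ne.symm hΔ)]))

end LLF

theorem mainTheorem3
    (S : LLF.Sig) (hS : LLF.WfSig S) (hSr : LLF.Sig.Respects S)
    (Ψ : LLF.TVar → Option LLF.Arity) (Ξ : LLF.CVar → Option LLF.Schema)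
    (F : LLF.Formula) (hF : F.Wf S Ψ Ξ)
    (θ : LLF.TSub) (hθ : ∀ x M α, θ x = some (M, α) → M.ClosedAt 0)
    (hθΨ : ∀ x, (Ψ x).isSome → (θ x).isSome)
    (Fθ : LLF.Formula) (hFθ : LLF.HSubF θ F Fθ)
    (Γ : LLF.CVar) (hFr : F.RespectsAt S Γ)
    (σ : LLF.CSub) (hσ : ∀ Γ' G, σ Γ' = some G → LLF.LCtx.Closed G)
    (hσΓ : σ Γ = none) (hσΞ : ∀ Γ', Γ' ≠ Γ → (Ξ Γ').isSome → (σ Γ').isSome)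
    (G G' : LLF.LCtx) (hGc : LLF.LCtx.Closed G) (hGc' : LLF.LCtx.Closed G')
    (hG : LLF.WfCtx S G) (hG' : LLF.WfCtx S G') (hGr' : LLF.LCtx.Respects S G')
    (hsub : LLF.CESub S Γ F G G') :
    LLF.Valid S ((Fθ.csub σ).csub (.single Γ G)) ↔
      LLF.Valid S ((Fθ.csub σ).csub (.single Γ G')) := by
  exact (hsub.frel hFθ hFr hσΓ).valid_iff hS hSr hGc hGc' hG hG' hGr' hsub.subset
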